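/- **Setting.** Let $d\in\{2,3\}$, $L>0$, $\mathbb T^d=(\mathbb R/L\mathbb Z)^d$, $\nu>0$, $T>0$. For $f\in L^2(\mathbb T^d;\mathbb R^d)$ write $f=\sum_{k}\hat f_k e^{ik\cdot x}$, $k\in\frac{2\pi}{L}\mathbb Z^d$. For $r\ge 0$ let $\mathbb H^r$ be the space of those $f$ with $\hat f_0=0$, $k\cdot\hat f_k=0$ for all $k$ and $\|f\|_{H^r}=(\sum_k|k|^{2r}|\hat f_k|^2)^{1/2}<\infty$. For $a\ge0$ let $e^{aA^{1/2}}f=\sum_k e^{a|k|}\hat f_ke^{ik\cdot x}$ and $G^{1,r}_a=\{f\in\mathbb H^r:\|e^{aA^{1/2}}f\|_{H^r}<\infty\}$. Let $C^\infty_{\mathrm{div}}(\mathbb T^d)$ be the space of smooth divergence-free vector fields on $\mathbb T^d$ with the topology of uniform convergence of all derivatives. Let $(\Omega,\mathcal F,(\mathcal F_t)_{t\ge0},\mathbb P)$ be a probability space with a complete right-continuous filtration, and let $(W^k)_{k\ge1}$ be real $(\mathcal F_t)$-Brownian motions. Stopping times take values in $[0,T]$. With the Leray projector $P$, consider $$du+[P((u\cdot\nabla)u)-\nu\Delta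 u]\,dt=\tfrac12\sum_{k\ge1}P\big((\xi_k\cdot\nabla)(\xi_k\cdot\nabla)u\big)\,dt+\sum_{k\ge1}P\big[g_k(t,u)-(\xi_k\cdot\nabla)u\big]\,dW^k_t,\qquad \operatorname{div}u=0,\quad u(0)=u_0. \tag{1}$$ **Assumptions.** * There is a constant $C$ such that almost surely, for all $t\in[0,T]$ and $v,w\in G^{1,1}_t$, $$\sum_k\|e^{tA^{1/2}}g_k(t,v)\|_{H^1}\le C\big(1+\|e^{tA^{1/2}}v\|_{H^1}\big),\qquad \sum_k\|e^{tA^{1/2}}[g_k(t,v)-g_k(t,w)]\|_{H^1}\le C\|e^{tA^{1/2}}(v-w)\|_{H^1},$$ and $\int_{\mathbb T^d}g_k(t,v)\,dx=0$ for every $k$. * For some $r_0>4$ and some $K<\infty$, the time-independent deterministic fields satisfy $\xi_k\in\mathbb H^{r_0}$ for every $k$ (so $\operatorname{div}\xi_k=0$) and $\sum_k\|e^{TA^{1/2}}\xi_k\|_{H^{r_0}}\le K$. * $u_0$ is $\mathcal F_0$-measurable, $u_0\in\mathbb H^1$ a.s., and $\|u_0\|_{H^1}^2\le K_0$ a.s.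 for a deterministic constant $K_0$. **Solutions.** A *local strong pathwise solution* of (1) is a pair $(u,\tau)$ of an a.s. strictly positive stopping time $\tau$ and an $\mathbb H^1$-valued progressively measurable process $u$ on $[0,\tau)$ for which there are a.s. strictly positive stopping times $\tau_1\le\tau_2\le\cdots$ with $\tau_l<\tau$ and $\tau_l\to\tau$ a.s. such that, for every $l$, almost surely $u(\cdot\wedge\tau_l)\in C([0,T];\mathbb H^1)\cap L^2(0,T;\mathbb H^2)$ and, for every $\phi\in C^\infty_{\mathrm{div}}(\mathbb T^d)$, almost surely for all $t\in[0,T]$, $$\begin{aligned}\langle u(t\wedge\tau_l),\phi\rangle&+\nu\int_0^{t\wedge\tau_l}\langle\nabla u,\nabla\phi\rangle\,d\sigma+\int_0^{t\wedge\tau_l}\langle(u\cdot\nabla)u,\phi\rangle\,d\sigma=\langle u_0,\phi\rangle-\tfrac12\sum_k\int_0^{t\wedge\tau_l}\langle(\xi_k\cdot\nabla)u,(\xi_k\cdot\nabla)\phi\rangle\,d\sigma\\&+\sum_k\int_0^{t\wedge\tau_l}\langle g_k(\sigma,u),\phi\rangle\,dW^k_\sigma-\sum_k\int_0^{t\wedge\tau_l}\langle(\xi_k\cdot\nabla)u,\phi\rangle\,dW^k_\sigma,\end{aligned}$$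 where $\langle\cdot,\cdot\rangle$ is the $L^2$ inner product, the stochastic integrals are Itô integrals and their series converge in probability uniformly on $[0,T]$. It is *maximal* if every local strong pathwise solution $(u',\tau')$ of (1) satisfies $\tau'\le\tau$ a.s. and $u=u'$ a.e. on $\Omega\times[0,\tau')\times\mathbb T^d$. A *Gevrey-class-1 solution* is a maximal strong pathwise solution $(u,\tau)$, with $u$ defined also at time $\tau$, such that almost surely $u(\cdot\wedge\tau)\in C((0,T];G^{1,1}_{(\cdot)})$, that is, $u(t\wedge\tau)\in G^{1,1}_t$ for all $t\in(0,T]$ and $t\mapsto e^{tA^{1/2}}u(t\wedge\tau)$ is continuous from $(0,T]$ to $\mathbb H^1$. **Corollary (instantaneous smoothing).** Under these assumptions, every Gevrey-class-1 solution $(u,\tau)$ of (1) satisfies $u(\cdot\wedge\tau)\in C\big((0,T];C^\infty_{\mathrm{div}}(\mathbb T^d)\big)$ almost surely. -/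

import Mathlib

open MeasureTheory ProbabilityTheory Filter Topology
open scoped NNReal ENNReal

noncomputable section

namespace StochNS

/-! ### Vector fields on the torus and their Fourier coefficients -/

/-- The torus `(ℝ / Lℤ)^d`. -/
abbrev Torus (d : ℕ) (L : ℝ) : Type := Fin d → AddCircle L

/-- The values `ℝ^d` of vector fields, with the Euclidean norm. -/
abbrev Vec (d : ℕ) : Type := EuclideanSpace ℝ (Fin d)

/-- The space `L²(𝕋^d; ℝ^d)` of square integrable real vector fields. -/
abbrev L2Field (d : ℕ) (L : ℝ) [Fact (0 < L)] : Type :=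
  Lp (Vec d) 2 (volume : Measure (Torus d L))

/-- The Euclidean length `|k|` of the frequency `k = (2π / L) n`, `n ∈ ℤ^d`. -/
def waveNumber (d : ℕ) (L : ℝ) (n : Fin d → ℤ) : ℝ :=
  (2 * Real.pi / L) * Real.sqrt (∑ j, (n j : ℝ) ^ 2)

/-- The Fourier coefficient `f̂_k = L^{-d} ∫ e^{-i k·x} f(x) dx ∈ ℂ^d` for `k = (2π / L) n`, so that
`f = ∑_k f̂_k e^{i k·x}`. -/
def coeff {d : ℕ} {L : ℝ} [Fact (0 < L)] (f : L2Field d L) (n : Fin d → ℤ) :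
    EuclideanSpace ℂ (Fin d) :=
  WithLp.toLp 2 fun i =>
    ((L : ℂ) ^ d)⁻¹ * ∫ x : Torus d L, (∏ j, fourier (-(n j)) (x j)) * ((f x i : ℝ) : ℂ)

/-- The homogeneous `H^r` norm `(∑_k |k|^{2r} |c_k|²)^{1/2}` of a family of Fourier coefficients,
with values in `[0, ∞]`. -/
def seqNorm {d : ℕ} (L r : ℝ) (c : (Fin d → ℤ) → EuclideanSpace ℂ (Fin d)) : ℝ≥0∞ :=
  (∑' n, ENNReal.ofReal (waveNumber d L n ^ (2 * r)) * ‖c n‖ₑ ^ 2) ^ (1 / 2 : ℝ)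

/-- The Fourier coefficients `e^{a |k|^{1/s}} f̂_k` of `e^{a A^{1/(2s)}} f`, where the Stokes operator
`A` has the symbol `|k|²`. -/
def gevreyCoeff {d : ℕ} {L : ℝ} [Fact (0 < L)] (s a : ℝ) (f : L2Field d L) (n : Fin d → ℤ) :
    EuclideanSpace ℂ (Fin d) :=
  Real.exp (a * waveNumber d L n ^ (1 / s)) • coeff f n

/-- `‖e^{a A^{1/(2s)}} f‖_{H^r} ∈ [0, ∞]`. -/
def gevreyNorm {d : ℕ} {L : ℝ} [Fact (0 < L)] (s r a : ℝ) (f : L2Field d L) : ℝ≥0∞ :=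
  seqNorm L r (gevreyCoeff s a f)

/-- `‖f‖_{H^r} ∈ [0, ∞]`. -/
def sobolevNorm {d : ℕ} {L : ℝ} [Fact (0 < L)] (r : ℝ) (f : L2Field d L) : ℝ≥0∞ :=
  seqNorm L r (coeff f)

/-- Membership in `ℍ^r`: mean-free, divergence-free, with finite `H^r` norm. -/
structure MemH {d : ℕ} {L : ℝ} [Fact (0 < L)] (r : ℝ) (f : L2Field d L) : Prop where
  meanFree : coeff f 0 = 0
  divFree : ∀ n : Fin d → ℤ, ∑ j, (n j : ℂ) * coeff f n j = 0
  finite : sobolevNorm r f < ∞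

/-- Membership in the Gevrey space `G^{s,r}_a = D(e^{a A^{1/(2s)}} : ℍ^r)`. -/
structure MemGevrey {d : ℕ} {L : ℝ} [Fact (0 < L)] (s r a : ℝ) (f : L2Field d L) : Prop where
  memH : MemH r f
  finite : gevreyNorm s r a f < ∞

/-- `w ∈ C(S; ℍ^r)` for a set `S` of times. -/
def ContH {d : ℕ} {L : ℝ} [Fact (0 < L)] (r : ℝ) (S : Set ℝ≥0) (w : ℝ≥0 → L2Field d L) : Prop :=
  (∀ t ∈ S, MemH r (w t)) ∧
    ∀ t₀ ∈ S, Tendsto (fun t => sobolevNorm r (w t - w t₀)) (𝓝[S] t₀) (𝓝 0)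

/-- `w ∈ C(S; G^{s,r}_{φ(·)})`: each `w t` lies in `G^{s,r}_{φ(t)}`, and
`t ↦ e^{φ(t) A^{1/(2s)}} w(t)` is continuous on `S` with values in `ℍ^r`. -/
def ContGevrey {d : ℕ} {L : ℝ} [Fact (0 < L)] (s r : ℝ) (φ : ℝ≥0 → ℝ) (S : Set ℝ≥0)
    (w : ℝ≥0 → L2Field d L) : Prop :=
  (∀ t ∈ S, MemGevrey s r (φ t) (w t)) ∧
    ∀ t₀ ∈ S, Tendsto
      (fun t => seqNorm L r fun n => gevreyCoeff s (φ t) (w t) n - gevreyCoeff s (φ t₀) (w t₀) n)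
      (𝓝[S] t₀) (𝓝 0)

/-! ### Smooth functions and weak derivatives -/

/-- The periodic function on `ℝ^d` that corresponds to a function on the torus. -/
def lift {d : ℕ} {L : ℝ} {X : Type} (f : Torus d L → X) (y : Vec d) : X :=
  f fun j => (y j : AddCircle L)

/-- Smooth functions on the torus. -/
def IsSmooth {d : ℕ} {L : ℝ} {X : Type} [NormedAddCommGroup X] [NormedSpace ℝ X]
    (f : Torus d L → X) : Prop :=
  ContDiff ℝ ((⊤ : ℕ∞) : WithTop ℕ∞) (lift f)

/-- The classical partial derivative `∂_j f`. -/
def pderiv {d : ℕ} {L : ℝ} {X : Type} [NormedAddCommGroup X] [NormedSpace ℝ X]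
    (j : Fin d) (f : Torus d L → X) (x : Torus d L) : X :=
  deriv (fun h : ℝ => f (x + Pi.single j (h : AddCircle L))) 0

/-- `f ∈ C^∞_div`: smooth and divergence-free. -/
def IsSmoothDiv {d : ℕ} {L : ℝ} (f : Torus d L → Vec d) : Prop :=
  IsSmooth f ∧ ∀ x, ∑ j, pderiv j f x j = 0

/-- `w ∈ C(S; C^∞_div)`: each `w t` has a representative `v t` in `C^∞_div`, and `t ↦ v t` is
continuous on `S` for the Fréchet topology of `C^∞`, the uniform convergence of all derivatives. -/
def ContSmoothDiv {d : ℕ} {L : ℝ} [Fact (0 < L)] (S : Set ℝ≥0) (w : ℝ≥0 → L2Field d L) : Prop :=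
  ∃ v : ℝ≥0 → Torus d L → Vec d,
    (∀ t ∈ S, IsSmoothDiv (v t) ∧ w t =ᵐ[volume] v t) ∧
    ∀ m : ℕ, ∀ t₀ ∈ S, TendstoUniformly
      (fun t => iteratedFDeriv ℝ m (lift (v t))) (iteratedFDeriv ℝ m (lift (v t₀))) (𝓝[S] t₀)

/-- `g` is the weak partial derivative `∂_j f`. -/
def IsWeakDeriv {d : ℕ} {L : ℝ} [Fact (0 < L)] (j : Fin d) (f g : L2Field d L) : Prop :=
  ∀ ψ : Torus d L → ℝ, IsSmooth ψ → ∫ x, pderiv j ψ x • f x = - ∫ x, ψ x • g x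

open Classical in
/-- The weak partial derivative `∂_j f ∈ L²` (it is unique where it exists, in particular on `ℍ^1`;
it is `0` by convention where there is none). -/
def weakDeriv {d : ℕ} {L : ℝ} [Fact (0 < L)] (j : Fin d) (f : L2Field d L) : L2Field d L :=
  if h : ∃ g, IsWeakDeriv j f g then h.choose else 0

/-- `(b · ∇) f` for a field `b` and a field `f` with partial derivatives `Df j`. -/
def advect {d : ℕ} {L : ℝ} (b : Torus d L → Vec d) (Df : Fin d → Torus d L → Vec d)
    (x : Torus d L) : Vec d :=
  ∑ j, b x j • Df j x

/-- `(b · ∇) f` with weak derivatives of `f`. -/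
def wAdvect {d : ℕ} {L : ℝ} [Fact (0 < L)] (b f : L2Field d L) : Torus d L → Vec d :=
  advect b fun j => weakDeriv j f

/-- `(b · ∇) φ` with classical derivatives of `φ`. -/
def cAdvect {d : ℕ} {L : ℝ} [Fact (0 < L)] (b : L2Field d L) (φ : Torus d L → Vec d) :
    Torus d L → Vec d :=
  advect b fun j => pderiv j φ

/-- The `L²` inner product `⟨f, g⟩` of vector fields. -/
def pairing {d : ℕ} {L : ℝ} [Fact (0 < L)] (f g : Torus d L → Vec d) : ℝ :=
  ∫ x, inner ℝ (f x) (g x)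

/-! ### Stochastic basis, Brownian motions, Itô integrals -/

/-- The usual conditions: the filtration is right-continuous and `F 0` contains all null sets. -/
structure UsualConditions {Ω : Type*} {m : MeasurableSpace Ω} (P : Measure Ω)
    (F : Filtration ℝ≥0 m) : Prop where
  rightCont : ∀ t : ℝ≥0, ⨅ r > t, F r = F t
  complete : ∀ A : Set Ω, P A = 0 → MeasurableSet[F 0] A

/-- Lebesgue measure on the time axis `[0, ∞)`. -/
def timeMeasure : Measure ℝ≥0 :=
  Measure.comap (fun t : ℝ≥0 => (t : ℝ)) volume

/-- `B` is a real Brownian motion relative to the filtration `F`. -/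
structure IsBrownian {Ω : Type*} {m : MeasurableSpace Ω} (P : Measure Ω)
    (F : Filtration ℝ≥0 m) (B : ℝ≥0 → Ω → ℝ) : Prop where
  brownian : IsBrownianReal B P
  adapted : StronglyAdapted F B
  indep : ∀ t h : ℝ≥0,
    Indep (MeasurableSpace.comap (fun ω => B (t + h) ω - B t ω) inferInstance) (F t) P

/-- A stopping time with values in `[0, T]`. -/
def IsStoppingTimeUpTo {Ω : Type*} {m : MeasurableSpace Ω} (F : Filtration ℝ≥0 m) (T : ℝ≥0)
    (τ : Ω → ℝ≥0) : Prop :=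
  IsStoppingTime F (fun ω => (τ ω : WithTop ℝ≥0)) ∧ ∀ ω, τ ω ≤ T

/-- A simple process `∑_{i < N} H_i 1_{(t_i, t_{i+1}]}` with `H_i` bounded and `F_{t_i}`-measurable. -/
structure SimpleProcess {Ω : Type*} {m : MeasurableSpace Ω} (F : Filtration ℝ≥0 m) where
  N : ℕ
  time : ℕ → ℝ≥0
  mono : Monotone time
  H : ℕ → Ω → ℝ
  meas : ∀ i, StronglyMeasurable[F (time i)] (H i)
  bounded : ∃ C : ℝ, ∀ i ω, |H i ω| ≤ C

/-- The value of a simple process. -/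
def SimpleProcess.val {Ω : Type*} {m : MeasurableSpace Ω} {F : Filtration ℝ≥0 m}
    (X : SimpleProcess F) (t : ℝ≥0) (ω : Ω) : ℝ :=
  ∑ i ∈ Finset.range X.N, if X.time i < t ∧ t ≤ X.time (i + 1) then X.H i ω else 0

/-- The stochastic integral `∫_0^t X dB` of a simple process. -/
def SimpleProcess.integral {Ω : Type*} {m : MeasurableSpace Ω} {F : Filtration ℝ≥0 m}
    (X : SimpleProcess F) (B : ℝ≥0 → Ω → ℝ) (t : ℝ≥0) (ω : Ω) : ℝ :=
  ∑ i ∈ Finset.range X.N, X.H i ω * (B (min t (X.time (i + 1))) ω - B (min t (X.time i)) ω)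

/-- Convergence in probability, uniformly on `[0, T]`. -/
def TendstoUCP {Ω : Type*} {m : MeasurableSpace Ω} (P : Measure Ω) (T : ℝ≥0)
    (X : ℕ → ℝ≥0 → Ω → ℝ) (Y : ℝ≥0 → Ω → ℝ) : Prop :=
  ∀ ε : ℝ, 0 < ε → Tendsto (fun n => P {ω | ∃ t ≤ T, ε ≤ |X n t ω - Y t ω|}) atTop (𝓝 0)

/-- `I` is (a version of) the Itô integral `∫_0^t f dB`, `t ∈ [0, T]`: `f` is progressively
measurable with `∫_0^T f² dt < ∞` a.s., and `I` is the limit, uniformly on `[0, T]` in probability,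
of the integrals of simple processes `X n` with `∫_0^T (X n - f)² dt → 0` in probability. -/
structure IsItoIntegral {Ω : Type*} {m : MeasurableSpace Ω} (P : Measure Ω)
    (F : Filtration ℝ≥0 m) (T : ℝ≥0) (B f I : ℝ≥0 → Ω → ℝ) : Prop where
  progressive : IsStronglyProgressive F f
  sqIntegrable : ∀ᵐ ω ∂P, ∫⁻ t in Set.Iic T, ‖f t ω‖ₑ ^ 2 ∂timeMeasure < ∞
  approx : ∃ X : ℕ → SimpleProcess F,
    (∀ ε : ℝ≥0∞, 0 < ε → Tendsto
      (fun n => P {ω | ε ≤ ∫⁻ t in Set.Iic T, ‖(X n).val t ω - f t ω‖ₑ ^ 2 ∂timeMeasure}) atTop (𝓝 0)) ∧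
    TendstoUCP P T (fun n => (X n).integral B) I

/-- `M` is (a version of) the series `∑_k ∫_0^t f_k dW^k`, `t ∈ [0, T]`, of Itô integrals, converging
uniformly on `[0, T]` in probability. -/
def IsItoSeries {Ω : Type*} {m : MeasurableSpace Ω} (P : Measure Ω)
    (F : Filtration ℝ≥0 m) (T : ℝ≥0) (W f : ℕ → ℝ≥0 → Ω → ℝ) (M : ℝ≥0 → Ω → ℝ) : Prop :=
  ∃ I : ℕ → ℝ≥0 → Ω → ℝ, (∀ k, IsItoIntegral P F T (W k) (f k) (I k)) ∧
    TendstoUCP P T (fun n t ω => ∑ k ∈ Finset.range n, I k t ω) M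

/-! ### The equation and its solutions -/

/-- The data of the equation: viscosity, transport noise coefficients `ξ k`, body forces
`g k t ω v = 𝐠_k(t, v)(ω)`, and the initial velocity. -/
structure NSData (d : ℕ) (L : ℝ) [Fact (0 < L)] (Ω : Type*) where
  ν : ℝ
  ξ : ℕ → L2Field d L
  g : ℕ → ℝ≥0 → Ω → L2Field d L → L2Field d L
  u₀ : Ω → L2Field d L

/-- Growth and Lipschitz condition on `g` and mean-freeness, in the Gevrey class of parameters
`s`, `r` and (possibly time-dependent) radius `σ`. -/
structure ForceAssumption {d : ℕ} {L : ℝ} [Fact (0 < L)] {Ω : Type*} {m : MeasurableSpace Ω}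
    (P : Measure Ω) (T : ℝ≥0) (s r : ℝ) (σ : ℝ≥0 → ℝ)
    (g : ℕ → ℝ≥0 → Ω → L2Field d L → L2Field d L) : Prop where
  growth : ∃ C : ℝ≥0, ∀ᵐ ω ∂P, ∀ t ≤ T, ∀ v : L2Field d L, MemGevrey s r (σ t) v →
    ∑' k, gevreyNorm s r (σ t) (g k t ω v) ≤ C * (1 + gevreyNorm s r (σ t) v)
  lipschitz : ∃ C : ℝ≥0, ∀ᵐ ω ∂P, ∀ t ≤ T, ∀ v w : L2Field d L,
    MemGevrey s r (σ t) v → MemGevrey s r (σ t) w →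
    ∑' k, gevreyNorm s r (σ t) (g k t ω v - g k t ω w) ≤ C * gevreyNorm s r (σ t) (v - w)
  meanFree : ∀ᵐ ω ∂P, ∀ t ≤ T, ∀ v : L2Field d L, MemGevrey s r (σ t) v →
    ∀ k, ∫ x, g k t ω v x = 0

/-- The transport coefficients are mean-free, divergence-free elements of `ℍ^r` with
`∑_k ‖e^{σ A^{1/(2s)}} ξ_k‖_{H^r} ≤ K`. -/
structure TransportAssumption {d : ℕ} {L : ℝ} [Fact (0 < L)] (s r σ : ℝ) (K : ℝ≥0)
    (ξ : ℕ → L2Field d L) : Prop where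
  memH : ∀ k, MemH r (ξ k)
  bound : ∑' k, gevreyNorm s r σ (ξ k) ≤ K

/-- The process `u` on the stochastic interval `[0, τ)`, extended by `0`. -/
def restrictTo {d : ℕ} {L : ℝ} [Fact (0 < L)] {Ω : Type*} (τ : Ω → ℝ≥0)
    (u : ℝ≥0 → Ω → L2Field d L) (t : ℝ≥0) (ω : Ω) : L2Field d L :=
  if t < τ ω then u t ω else 0

/-- The weak form of the equation, stopped at `ρ` and tested with `φ`; the Itô integrals up to
`t ∧ ρ` are the integrals up to `t` of the integrands multiplied by `1_{σ ≤ ρ}`. -/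
def WeakEquation {d : ℕ} {L : ℝ} [Fact (0 < L)] {Ω : Type*} {m : MeasurableSpace Ω}
    (P : Measure Ω) (F : Filtration ℝ≥0 m) (T : ℝ≥0) (W : ℕ → ℝ≥0 → Ω → ℝ) (D : NSData d L Ω)
    (u : ℝ≥0 → Ω → L2Field d L) (ρ : Ω → ℝ≥0) (φ : Torus d L → Vec d) : Prop :=
  ∃ M N : ℝ≥0 → Ω → ℝ,
    IsItoSeries P F T W
      (fun k σ ω => if σ ≤ ρ ω then pairing (D.g k σ ω (u σ ω)) φ else 0) M ∧
    IsItoSeries P F T W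
      (fun k σ ω => if σ ≤ ρ ω then pairing (wAdvect (D.ξ k) (u σ ω)) φ else 0) N ∧
    ∀ᵐ ω ∂P, ∀ t ≤ T,
      Summable (fun k => ∫ σ in Set.Iic (min t (ρ ω)),
        pairing (wAdvect (D.ξ k) (u σ ω)) (cAdvect (D.ξ k) φ) ∂timeMeasure) ∧
      pairing (u (min t (ρ ω)) ω) φ
          + D.ν * (∫ σ in Set.Iic (min t (ρ ω)),
              ∑ j, pairing (weakDeriv j (u σ ω)) (pderiv j φ) ∂timeMeasure)
          + (∫ σ in Set.Iic (min t (ρ ω)), pairing (wAdvect (u σ ω) (u σ ω)) φ ∂timeMeasure)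
        = pairing (D.u₀ ω) φ
          - (1 / 2) * (∑' k, ∫ σ in Set.Iic (min t (ρ ω)),
              pairing (wAdvect (D.ξ k) (u σ ω)) (cAdvect (D.ξ k) φ) ∂timeMeasure)
          + M t ω - N t ω

/-- `(u, τ)` is a local strong pathwise solution with values in `ℍ^r`. Only the values of `u` on the
stochastic interval `[0, τ)` matter here. -/
structure IsLocalSolution {d : ℕ} {L : ℝ} [Fact (0 < L)] {Ω : Type*} {m : MeasurableSpace Ω}
    (P : Measure Ω) (F : Filtration ℝ≥0 m) (T : ℝ≥0) (W : ℕ → ℝ≥0 → Ω → ℝ) (D : NSData d L Ω)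
    (r : ℝ) (u : ℝ≥0 → Ω → L2Field d L) (τ : Ω → ℝ≥0) : Prop where
  one_le : 1 ≤ r
  stopping : IsStoppingTimeUpTo F T τ
  pos : ∀ᵐ ω ∂P, 0 < τ ω
  memH : ∀ᵐ ω ∂P, ∀ t < τ ω, MemH r (u t ω)
  progressive : IsStronglyProgressive F (restrictTo τ u)
  announced : ∃ τl : ℕ → Ω → ℝ≥0,
    (∀ l, IsStoppingTimeUpTo F T (τl l)) ∧
    (∀ᵐ ω ∂P, (∀ l, 0 < τl l ω ∧ τl l ω < τ ω) ∧ Monotone (fun l => τl l ω) ∧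
      Tendsto (fun l => τl l ω) atTop (𝓝 (τ ω))) ∧
    (∀ l, ∀ᵐ ω ∂P, ContH r (Set.Iic T) (fun t => u (min t (τl l ω)) ω) ∧
      ∫⁻ t in Set.Iic T, sobolevNorm (r + 1) (u (min t (τl l ω)) ω) ^ 2 ∂timeMeasure < ∞) ∧
    ∀ l, ∀ φ : Torus d L → Vec d, IsSmoothDiv φ →
      WeakEquation P F T W D (restrictTo τ u) (τl l) φ

/-- `(u, τ)` is a maximal strong pathwise solution with values in `ℍ^r`. -/
structure IsMaximalSolution {d : ℕ} {L : ℝ} [Fact (0 < L)] {Ω : Type*} {m : MeasurableSpace Ω}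
    (P : Measure Ω) (F : Filtration ℝ≥0 m) (T : ℝ≥0) (W : ℕ → ℝ≥0 → Ω → ℝ) (D : NSData d L Ω)
    (r : ℝ) (u : ℝ≥0 → Ω → L2Field d L) (τ : Ω → ℝ≥0) : Prop where
  isLocal : IsLocalSolution P F T W D r u τ
  maximal : ∀ (u' : ℝ≥0 → Ω → L2Field d L) (τ' : Ω → ℝ≥0),
    IsLocalSolution P F T W D r u' τ' →
      (∀ᵐ ω ∂P, τ' ω ≤ τ ω) ∧ ∀ᵐ ω ∂P, ∀ᵐ t ∂timeMeasure, t < τ' ω → u t ω = u' t ω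

/-- `(u, τ)` is a Gevrey-class-`(s, r, φ(t))` solution. -/
structure IsGevreySolution {d : ℕ} {L : ℝ} [Fact (0 < L)] {Ω : Type*} {m : MeasurableSpace Ω}
    (P : Measure Ω) (F : Filtration ℝ≥0 m) (T : ℝ≥0) (W : ℕ → ℝ≥0 → Ω → ℝ) (D : NSData d L Ω)
    (s r : ℝ) (φ : ℝ≥0 → ℝ) (u : ℝ≥0 → Ω → L2Field d L) (τ : Ω → ℝ≥0) : Prop where
  maximal : IsMaximalSolution P F T W D r u τ
  gevrey : ∀ᵐ ω ∂P, ContGevrey s r φ (Set.Ioc 0 T) fun t => u (min t (τ ω)) ω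

end StochNS

end

namespace StochNS

variable {d : ℕ} {L : ℝ}

/-! ### Exponential monomials on the torus -/

/-! The argument is deterministic and runs path by path. Fix a path that is continuous into the
Gevrey spaces of radius `t`. One term of the norm of `G^{1,1}_t` gives `|k| e^{t|k|} |f̂_k| ≤
‖e^{tA^{1/2}} f‖_{H^1}`. Nonzero frequencies satisfy `|k| ≥ 2π/L` and the mean vanishes, so `|f̂_k|
≤ B e^{-t|k|}` for all `k`. For `t > 0` this makes `|k|^m |f̂_k|` summable for every `m`
(`MemGevrey.rapidDecay`).

The Fourier series and all its formal derivatives then converge uniformly, so the sum is smooth, and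
it is divergence-free because `k·f̂_k = 0` (`RapidDecay.isSmoothDiv`). It represents `f` almost
everywhere, since the exponentials are complete in `L²` (`ae_eq_fieldSeries_coeff`).

For continuity in time, the sup norm of the difference of two `m`-th derivatives is at most the
weighted `ℓ¹` distance of the coefficients (`RapidDecay.norm_iteratedFDeriv_sub_le`). That distance
tends to zero by dominated convergence: each coefficient is continuous in time
(`ContGevrey.tendsto_coeff`), and near `t₀ > 0` all coefficients share the bound `B e^{-t₀|k|/2}`
(`ContGevrey.exists_eventually_norm_coeff_le`). The moving radius `t` matters only through these two
facts. -/

/-- The exponential monomial `e^{i k·x}`, `k = (2π / L) n`. -/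
noncomputable def monomial (n : Fin d → ℤ) : C(Torus d L, ℂ) where
  toFun x := ∏ j, fourier (n j) (x j)
  continuous_toFun := by fun_prop

theorem monomial_apply (n : Fin d → ℤ) (x : Torus d L) :
    monomial n x = ∏ j, fourier (n j) (x j) := rfl

theorem monomial_neg (n : Fin d → ℤ) (x : Torus d L) :
    monomial (-n) x = (starRingEnd ℂ) (monomial n x) := by
  simp only [monomial_apply, Pi.neg_apply, fourier_neg, map_prod]

theorem monomial_add (m n : Fin d → ℤ) (x : Torus d L) :
    monomial (m + n) x = monomial m x * monomial n x := by
  simp only [monomial_apply, Pi.add_apply, fourier_add, ← Finset.prod_mul_distrib]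

theorem monomial_zero (x : Torus d L) : monomial (0 : Fin d → ℤ) x = 1 := by
  simp only [monomial_apply, Pi.zero_apply, fourier_zero, Finset.prod_const_one]

theorem norm_monomial_apply (n : Fin d → ℤ) (x : Torus d L) : ‖monomial n x‖ = 1 := by
  simp only [monomial_apply, norm_prod, fourier_apply, Circle.norm_coe, Finset.prod_const_one]

theorem monomial_single (i : Fin d) (x : Torus d L) :
    monomial (Pi.single i 1) x = fourier 1 (x i) := by
  rw [monomial_apply, Finset.prod_eq_single i]
  · rw [Pi.single_eq_same]
  · intro j _ hj
    rw [Pi.single_eq_of_ne hj, fourier_zero]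
  · simp

/-! ### Completeness of the exponentials in `L²`. -/

/-- The star subalgebra of `C(𝕋^d, ℂ)` generated by the exponential monomials. -/
noncomputable def monomialSubalgebra (d : ℕ) (L : ℝ) : StarSubalgebra ℂ C(Torus d L, ℂ) where
  toSubalgebra := Algebra.adjoin ℂ (Set.range monomial)
  star_mem' := by
    change Algebra.adjoin ℂ (Set.range monomial) ≤ star (Algebra.adjoin ℂ (Set.range monomial))
    refine Algebra.adjoin_le ?_
    rintro _ ⟨n, rfl⟩
    refine Algebra.subset_adjoin ⟨-n, ?_⟩
    ext1 x
    simp only [monomial_neg, starRingEnd_apply, ContinuousMap.star_apply]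

/-- The exponentials already form a multiplicative monoid, so taking products adds nothing to their
linear span. -/
theorem monomialSubalgebra_coe :
    (monomialSubalgebra d L).toSubalgebra.toSubmodule =
      Submodule.span ℂ (Set.range (monomial (d := d) (L := L))) := by
  apply Algebra.adjoin_eq_span_of_subset
  refine .trans (fun x ↦ Submonoid.closure_induction (fun _ ↦ id) ⟨0, ?_⟩ ?_)
    Submodule.subset_span
  · ext z
    exact monomial_zero z
  · rintro _ _ _ _ ⟨m, rfl⟩ ⟨n, rfl⟩
    refine ⟨m + n, ?_⟩
    ext z
    exact monomial_add m n z

theorem continuous_tsum_monomial {c : (Fin d → ℤ) → ℂ} (hc : Summable fun n => ‖c n‖) :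
    Continuous fun x : Torus d L => ∑' n, c n * monomial n x :=
  continuous_tsum (fun n => continuous_const.mul (monomial n).continuous) hc fun n x => by
    rw [norm_mul, norm_monomial_apply, mul_one]

variable [hL : Fact (0 < L)]

/-- Distinct points differ in some coordinate, and the first harmonic in that coordinate is
injective on `ℝ / Lℤ`. -/
theorem monomialSubalgebra_separatesPoints :
    (monomialSubalgebra d L).SeparatesPoints := by
  intro x y hxy
  rw [Ne, funext_iff, not_forall] at hxy
  obtain ⟨i, hi⟩ := hxy
  refine ⟨_, ⟨monomial (Pi.single i 1), Algebra.subset_adjoin ⟨Pi.single i 1, rfl⟩, rfl⟩, ?_⟩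
  dsimp only
  rw [monomial_single, monomial_single, fourier_one, fourier_one]
  contrapose hi
  exact AddCircle.injective_toCircle hL.out.ne' (Circle.ext hi)

/-- Stone–Weierstrass on the compact torus. -/
theorem span_monomial_closure_eq_top :
    (Submodule.span ℂ (Set.range (monomial (d := d) (L := L)))).topologicalClosure = ⊤ := by
  rw [← monomialSubalgebra_coe]
  exact congr_arg (Subalgebra.toSubmodule <| StarSubalgebra.toSubalgebra ·)
    (ContinuousMap.starSubalgebra_topologicalClosure_eq_top_of_separatesPoints _
      monomialSubalgebra_separatesPoints)

theorem span_monomial_toLp_closure_eq_top :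
    (Submodule.span ℂ (Set.range fun n : Fin d → ℤ =>
      ContinuousMap.toLp (E := ℂ) 2 (volume : Measure (Torus d L)) ℂ
        (monomial n))).topologicalClosure = ⊤ := by
  simpa only [Submodule.map_span, ContinuousLinearMap.coe_coe, ← Set.range_comp,
    Function.comp_def] using
    (ContinuousMap.toLp_denseRange ℂ (volume : Measure (Torus d L)) ℂ
      (by norm_num : (2 : ℝ≥0∞) ≠ ∞)).topologicalClosure_map_submodule
      span_monomial_closure_eq_top

/-- A square integrable function all of whose Fourier coefficients vanish is zero. -/
theorem ae_eq_zero_of_integral_monomial_eq_zero {h : Torus d L → ℂ}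
    (hh : MemLp h 2 volume) (h0 : ∀ n : Fin d → ℤ, ∫ x, monomial (-n) x * h x = 0) :
    h =ᵐ[volume] 0 := by
  have key : hh.toLp h = 0 := by
    -- Vanishing coefficients mean orthogonality to every exponential, hence to a dense subspace.
    have hmem : hh.toLp h ∈ (Submodule.span ℂ (Set.range fun n : Fin d → ℤ =>
        ContinuousMap.toLp (E := ℂ) 2 (volume : Measure (Torus d L)) ℂ (monomial n)))ᗮ := by
      rw [Submodule.mem_orthogonal]
      intro v hv
      induction hv using Submodule.span_induction with
      | mem v hv =>
        obtain ⟨n, rfl⟩ := hv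
        rw [L2.inner_def, ← h0 n]
        refine integral_congr_ae ?_
        filter_upwards [hh.coeFn_toLp,
          ContinuousMap.coeFn_toLp (E := ℂ) (p := 2) (𝕜 := ℂ) (volume : Measure (Torus d L))
            (monomial n)] with x hx1 hx2
        rw [hx1, hx2, RCLike.inner_apply, monomial_neg, mul_comm]
      | zero => exact inner_zero_left _
      | add v w _ _ hv hw => rw [inner_add_left, hv, hw, add_zero]
      | smul a v _ hv => rw [inner_smul_left, hv, mul_zero]
    rw [← Submodule.orthogonal_closure, span_monomial_toLp_closure_eq_top,
      Submodule.top_orthogonal_eq_bot] at hmem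
    simpa using hmem
  have h1 := hh.coeFn_toLp
  rw [key] at h1
  exact h1.symm.trans (Lp.coeFn_zero _ _ _)

/-! ### Orthogonality and Fourier inversion. -/

theorem integral_fourier_eq_ite (n : ℤ) :
    ∫ x : AddCircle L, fourier n x = if n = 0 then (L : ℂ) else 0 := by
  split_ifs with hn
  · subst hn
    simp only [fourier_zero, integral_const, measureReal_def, AddCircle.measure_univ,
      ENNReal.toReal_ofReal hL.out.le]
    simp
  -- Translation by half a wavelength flips the sign of the integrand but preserves the integral.
  · exact integral_eq_zero_of_add_right_eq_neg (fourier_add_half_inv_index hn hL.out)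

theorem integral_monomial (n : Fin d → ℤ) :
    ∫ x : Torus d L, monomial n x = if n = 0 then (L : ℂ) ^ d else 0 := by
  simp only [monomial_apply]
  rw [MeasureTheory.integral_fintype_prod_volume_eq_prod
    (f := fun j (x : AddCircle L) => fourier (n j) x)]
  simp only [integral_fourier_eq_ite]
  split_ifs with hn
  · subst hn
    simp
  · obtain ⟨i, hi⟩ := Function.ne_iff.mp hn
    exact Finset.prod_eq_zero (Finset.mem_univ i) (if_neg hi)

/-- The Fourier coefficients of an absolutely convergent Fourier series. -/
theorem integral_monomial_neg_mul_tsum {c : (Fin d → ℤ) → ℂ} (hc : Summable fun n => ‖c n‖)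
    (m : Fin d → ℤ) :
    ∫ x : Torus d L, monomial (-m) x * ∑' n, c n * monomial n x = (L : ℂ) ^ d * c m := by
  -- The factor shifts every frequency by `-m`; after termwise integration only `n = m` survives.
  have h1 : ∀ x : Torus d L, monomial (-m) x * ∑' n, c n * monomial n x =
      ∑' n, c n * monomial (n - m) x := by
    intro x
    rw [← tsum_mul_left]
    congr 1
    ext n
    rw [sub_eq_add_neg, monomial_add]
    ring
  simp only [h1]
  rw [← integral_tsum_of_summable_integral_norm]
  · simp only [integral_const_mul, integral_monomial, sub_eq_zero]
    rw [tsum_eq_single m]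
    · simp [mul_comm]
    · intro n hn
      simp [hn]
  · intro n
    exact ((monomial (n - m)).continuous.integrable_of_hasCompactSupport
      (HasCompactSupport.of_compactSpace _)).const_mul _
  · simp only [norm_mul, norm_monomial_apply, mul_one, integral_const, smul_eq_mul]
    exact hc.mul_left _

theorem coeff_apply (f : L2Field d L) (n : Fin d → ℤ) (i : Fin d) :
    coeff f n i = ((L : ℂ) ^ d)⁻¹ * ∫ x : Torus d L, monomial (-n) x * ((f x i : ℝ) : ℂ) := rfl

/-- A square integrable field with absolutely summable Fourier coefficients is the sum of its
Fourier series. -/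
theorem ae_eq_tsum_coeff (f : L2Field d L) (hf : Summable fun n => ‖coeff f n‖) (i : Fin d) :
    ∀ᵐ x, ((f x i : ℝ) : ℂ) = ∑' n, coeff f n i * monomial n x := by
  have hci : Summable fun n => ‖coeff f n i‖ :=
    Summable.of_nonneg_of_le (fun _ => norm_nonneg _) (fun n => PiLp.norm_apply_le _ _) hf
  have hfi : MemLp (fun x => ((f x i : ℝ) : ℂ)) 2 (volume : Measure (Torus d L)) := by
    refine MemLp.of_le (Lp.memLp f) ?_ ?_
    · have hm := (Lp.aestronglyMeasurable f)
      fun_prop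
    · refine Eventually.of_forall fun x => ?_
      rw [Complex.norm_real]
      exact PiLp.norm_apply_le _ _
  have hsum : MemLp (fun x : Torus d L => ∑' n, coeff f n i * monomial n x) 2 volume := by
    obtain ⟨C, hC⟩ := (isCompact_range (continuous_tsum_monomial (L := L) hci)).isBounded.exists_norm_le
    exact MemLp.of_bound (continuous_tsum_monomial hci).aestronglyMeasurable C
      (Eventually.of_forall fun x => hC _ ⟨x, rfl⟩)
  -- The component and its series are both in `L²` with equal Fourier coefficients, so completeness
  -- applies to their difference.
  have h0 := ae_eq_zero_of_integral_monomial_eq_zero (hfi.sub hsum) (fun n => by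
    have hint : ∀ {h : Torus d L → ℂ}, MemLp h 2 volume →
        Integrable (fun x => monomial (-n) x * h x) volume := fun hh =>
      (hh.integrable (by norm_num)).bdd_mul (c := 1) (monomial (-n)).continuous.aestronglyMeasurable
        (Eventually.of_forall fun x => (norm_monomial_apply _ x).le)
    simp only [Pi.sub_apply, mul_sub]
    rw [integral_sub (hint hfi) (hint hsum), integral_monomial_neg_mul_tsum hci, coeff_apply,
      mul_inv_cancel_left₀ (pow_ne_zero _ (by exact_mod_cast hL.out.ne')), sub_self])
  filter_upwards [h0] with x hx
  exact sub_eq_zero.mp hx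

end StochNS

namespace StochNS

variable {d : ℕ} {L : ℝ}

/-! ### Rapidly convergent Fourier series -/

/-- The frequency `k = (2π / L) n` as a vector. -/
noncomputable def waveVec (L : ℝ) (n : Fin d → ℤ) : Vec d :=
  WithLp.toLp 2 fun j => 2 * Real.pi / L * n j

/-- The phase `y ↦ k·y`. -/
noncomputable def phase (L : ℝ) (n : Fin d → ℤ) : Vec d →L[ℝ] ℝ :=
  innerSL ℝ (waveVec L n)

theorem phase_apply (n : Fin d → ℤ) (y : Vec d) :
    phase L n y = ∑ j, 2 * Real.pi / L * n j * y j := by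
  simp [phase, waveVec, PiLp.inner_apply, mul_comm]

theorem norm_phase (hL : 0 < L) (n : Fin d → ℤ) : ‖phase L n‖ = waveNumber d L n := by
  have h : waveVec L n = (2 * Real.pi / L) • (WithLp.toLp 2 fun j => (n j : ℝ) : Vec d) := by
    ext j
    simp [waveVec]
  rw [phase, innerSL_apply_norm, h, norm_smul, EuclideanSpace.norm_eq, waveNumber,
    Real.norm_of_nonneg (by positivity)]
  simp

theorem waveNumber_nonneg (hL : 0 < L) (n : Fin d → ℤ) : 0 ≤ waveNumber d L n := by
  unfold waveNumber
  positivity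

theorem lift_monomial (n : Fin d → ℤ) (y : Vec d) :
    lift (monomial (L := L) n) y = Complex.exp (Complex.I * phase L n y) := by
  simp only [lift, monomial_apply, fourier_coe_apply]
  rw [← Complex.exp_sum, phase_apply, Complex.ofReal_sum, Finset.mul_sum]
  congr 1
  refine Finset.sum_congr rfl fun j _ => ?_
  push_cast
  ring

theorem iteratedDeriv_exp_I_mul (m : ℕ) :
    iteratedDeriv m (fun s : ℝ => Complex.exp (Complex.I * s)) =
      fun s : ℝ => Complex.I ^ m * Complex.exp (Complex.I * s) := by
  induction m with
  | zero => simp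
  | succ m ih =>
    rw [iteratedDeriv_succ, ih]
    ext s
    have h : HasDerivAt (fun s : ℝ => Complex.exp (Complex.I * s))
        (Complex.exp (Complex.I * s) * (Complex.I * 1)) s :=
      ((Complex.ofRealCLM.hasDerivAt (x := s)).const_mul Complex.I).cexp
    rw [(h.const_mul _).deriv]
    ring

theorem contDiff_exp_I_mul {N : WithTop ℕ∞} :
    ContDiff ℝ N fun s : ℝ => Complex.exp (Complex.I * s) :=
  (contDiff_const.mul Complex.ofRealCLM.contDiff).cexp

theorem contDiff_lift_monomial {N : WithTop ℕ∞} (n : Fin d → ℤ) :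
    ContDiff ℝ N (lift (monomial (L := L) n)) := by
  rw [funext (lift_monomial (L := L) n)]
  exact contDiff_exp_I_mul.comp (phase L n).contDiff

/-- The exponential is `s ↦ e^{is}` after a linear phase: the derivatives of the former have modulus
one, and each of the `m` slots costs the norm `|k|` of the phase. -/
theorem norm_iteratedFDeriv_lift_monomial_le (hL : 0 < L) (m : ℕ) (n : Fin d → ℤ) (y : Vec d) :
    ‖iteratedFDeriv ℝ m (lift (monomial (L := L) n)) y‖ ≤ waveNumber d L n ^ m := by
  have h : lift (monomial (L := L) n) =
      (fun s : ℝ => Complex.exp (Complex.I * s)) ∘ phase L n := funext (lift_monomial n)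
  rw [h, (phase L n).iteratedFDeriv_comp_right contDiff_exp_I_mul y (i := m) (n := m) le_rfl]
  refine (ContinuousMultilinearMap.norm_compContinuousLinearMap_le _ _).trans ?_
  rw [norm_iteratedFDeriv_eq_norm_iteratedDeriv, iteratedDeriv_exp_I_mul, norm_mul, norm_pow,
    Complex.norm_I, mul_comm Complex.I, Complex.norm_exp_ofReal_mul_I]
  simp [norm_phase hL]

theorem fderiv_lift_monomial (n : Fin d → ℤ) (y v : Vec d) :
    fderiv ℝ (lift (monomial (L := L) n)) y v =
      Complex.I * phase L n v * lift (monomial (L := L) n) y := by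
  rw [funext (lift_monomial (L := L) n)]
  have h : HasFDerivAt (fun y : Vec d => Complex.exp (Complex.I * (phase L n y : ℂ))) _ y :=
    ((Complex.ofRealCLM.comp (phase L n)).hasFDerivAt.const_mul Complex.I).cexp
  rw [h.fderiv]
  simp
  ring

/-! ### Real fields with rapidly decaying coefficients. -/

/-- The real linear map `z ↦ Re (z a)` from `ℂ` to `ℝ^d`, for an amplitude `a ∈ ℂ^d`. -/
noncomputable def synth (a : EuclideanSpace ℂ (Fin d)) : ℂ →L[ℝ] Vec d :=
  LinearMap.mkContinuous
    { toFun := fun z => WithLp.toLp 2 fun i => (z * a i).re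
      map_add' := fun z w => by ext i; simp [add_mul]
      map_smul' := fun r z => by ext i; simp [mul_assoc] } ‖a‖ fun z => by
    rw [mul_comm, ← norm_smul, EuclideanSpace.norm_eq, EuclideanSpace.norm_eq]
    refine Real.sqrt_le_sqrt (Finset.sum_le_sum fun i _ => ?_)
    gcongr
    exact Complex.abs_re_le_norm _

theorem synth_apply (a : EuclideanSpace ℂ (Fin d)) (z : ℂ) (i : Fin d) :
    synth a z i = (z * a i).re := rfl

theorem norm_synth_le (a : EuclideanSpace ℂ (Fin d)) : ‖synth a‖ ≤ ‖a‖ :=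
  LinearMap.mkContinuous_norm_le _ (norm_nonneg _) _

theorem synth_sub (a b : EuclideanSpace ℂ (Fin d)) (z : ℂ) :
    synth (a - b) z = synth a z - synth b z := by
  ext i
  simp [synth_apply, mul_sub]

/-- The real field with Fourier coefficients `c`. -/
noncomputable def fieldSeries (c : (Fin d → ℤ) → EuclideanSpace ℂ (Fin d)) (x : Torus d L) :
    Vec d :=
  ∑' n, synth (c n) (monomial n x)

/-- The weighted family `|k|^m |c_k|` is summable for every `m`. -/
def RapidDecay (L : ℝ) (c : (Fin d → ℤ) → EuclideanSpace ℂ (Fin d)) : Prop :=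
  ∀ m : ℕ, Summable fun n => waveNumber d L n ^ m * ‖c n‖

theorem RapidDecay.summable_norm {c : (Fin d → ℤ) → EuclideanSpace ℂ (Fin d)}
    (hc : RapidDecay L c) : Summable fun n => ‖c n‖ := by
  simpa using hc 0

theorem RapidDecay.sub (hL : 0 < L) {c c' : (Fin d → ℤ) → EuclideanSpace ℂ (Fin d)}
    (hc : RapidDecay L c) (hc' : RapidDecay L c') : RapidDecay L (c - c') := fun m => by
  refine Summable.of_nonneg_of_le (fun n => ?_) (fun n => ?_) ((hc m).add (hc' m))
  · have := waveNumber_nonneg hL n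
    positivity
  · rw [← mul_add]
    exact mul_le_mul_of_nonneg_left (norm_sub_le _ _) (pow_nonneg (waveNumber_nonneg hL n) _)

theorem norm_synth_monomial_le (a : EuclideanSpace ℂ (Fin d)) (n : Fin d → ℤ) (x : Torus d L) :
    ‖synth a (monomial n x)‖ ≤ ‖a‖ := by
  refine ((synth a).le_opNorm _).trans ?_
  rw [norm_monomial_apply, mul_one]
  exact norm_synth_le a

theorem RapidDecay.summable_synth {c : (Fin d → ℤ) → EuclideanSpace ℂ (Fin d)}
    (hc : RapidDecay L c) (x : Torus d L) : Summable fun n => synth (c n) (monomial n x) :=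
  Summable.of_norm_bounded hc.summable_norm fun n => norm_synth_monomial_le (c n) n x

theorem fieldSeries_sub {c c' : (Fin d → ℤ) → EuclideanSpace ℂ (Fin d)}
    (hc : RapidDecay L c) (hc' : RapidDecay L c') (x : Torus d L) :
    fieldSeries (c - c') x = fieldSeries c x - fieldSeries c' x := by
  simp only [fieldSeries]
  rw [← (hc.summable_synth x).tsum_sub (hc'.summable_synth x)]
  simp only [Pi.sub_apply, synth_sub]

theorem contDiff_synth_lift_monomial {N : WithTop ℕ∞} (a : EuclideanSpace ℂ (Fin d))
    (n : Fin d → ℤ) : ContDiff ℝ N fun y : Vec d => synth a (lift (monomial (L := L) n) y) :=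
  (synth a).contDiff.comp (contDiff_lift_monomial n)

theorem norm_iteratedFDeriv_synth_le (hL : 0 < L) (m : ℕ) (a : EuclideanSpace ℂ (Fin d))
    (n : Fin d → ℤ) (y : Vec d) :
    ‖iteratedFDeriv ℝ m (fun y => synth a (lift (monomial (L := L) n) y)) y‖ ≤
      waveNumber d L n ^ m * ‖a‖ := by
  refine ((synth a).norm_iteratedFDeriv_comp_left (n := m)
    (contDiff_lift_monomial n).contDiffAt le_rfl).trans ?_
  rw [mul_comm]
  exact mul_le_mul (norm_iteratedFDeriv_lift_monomial_le hL m n y) (norm_synth_le a)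
    (norm_nonneg _) (pow_nonneg (waveNumber_nonneg hL n) _)

theorem lift_fieldSeries (c : (Fin d → ℤ) → EuclideanSpace ℂ (Fin d)) :
    lift (fieldSeries (L := L) c) =
      fun y => ∑' n, synth (c n) (lift (monomial (L := L) n) y) := rfl

/-- Weierstrass test for each order `m`, with majorant `|k|^m |c_k|`. -/
theorem RapidDecay.isSmooth (hL : 0 < L) {c : (Fin d → ℤ) → EuclideanSpace ℂ (Fin d)}
    (hc : RapidDecay L c) : IsSmooth (fieldSeries (L := L) c) := by
  rw [IsSmooth, lift_fieldSeries]
  exact contDiff_tsum (fun n => contDiff_synth_lift_monomial (c n) n) (fun m _ => hc m)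
    fun m n y _ => norm_iteratedFDeriv_synth_le hL m (c n) n y

theorem RapidDecay.norm_iteratedFDeriv_le (hL : 0 < L)
    {c : (Fin d → ℤ) → EuclideanSpace ℂ (Fin d)} (hc : RapidDecay L c) (m : ℕ) (y : Vec d) :
    ‖iteratedFDeriv ℝ m (lift (fieldSeries (L := L) c)) y‖ ≤
      ∑' n, waveNumber d L n ^ m * ‖c n‖ := by
  rw [lift_fieldSeries, iteratedFDeriv_tsum_apply (N := ⊤)
    (fun n => contDiff_synth_lift_monomial (c n) n) (fun m _ => hc m)
    (fun m n y _ => norm_iteratedFDeriv_synth_le hL m (c n) n y) le_top]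
  exact tsum_of_norm_bounded (hc m).hasSum fun n => norm_iteratedFDeriv_synth_le hL m (c n) n y

/-- By linearity the difference is the series of `c - c'`. This reduces convergence in the topology
of `C^∞` to weighted `ℓ¹` convergence of coefficients. -/
theorem RapidDecay.norm_iteratedFDeriv_sub_le (hL : 0 < L)
    {c c' : (Fin d → ℤ) → EuclideanSpace ℂ (Fin d)} (hc : RapidDecay L c) (hc' : RapidDecay L c')
    (m : ℕ) (y : Vec d) :
    ‖iteratedFDeriv ℝ m (lift (fieldSeries (L := L) c)) y -
        iteratedFDeriv ℝ m (lift (fieldSeries (L := L) c')) y‖ ≤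
      ∑' n, waveNumber d L n ^ m * ‖c n - c' n‖ := by
  have h : lift (fieldSeries (L := L) (c - c')) =
      lift (fieldSeries (L := L) c) - lift (fieldSeries (L := L) c') :=
    funext fun y => fieldSeries_sub hc hc' _
  have hm : (m : WithTop ℕ∞) ≤ ((⊤ : ℕ∞) : WithTop ℕ∞) := by exact_mod_cast le_top
  rw [← iteratedFDeriv_sub_apply ((hc.isSmooth hL).of_le hm).contDiffAt
    ((hc'.isSmooth hL).of_le hm).contDiffAt, ← h]
  exact (hc.sub hL hc').norm_iteratedFDeriv_le hL m y

/-- On smooth functions, the partial derivative on the torus is that of the periodic lift. -/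
theorem pderiv_eq_fderiv_lift {X : Type} [NormedAddCommGroup X] [NormedSpace ℝ X]
    {f : Torus d L → X} (hf : IsSmooth f) (j : Fin d) (y : Vec d) :
    pderiv j f (fun i => (y i : AddCircle L)) =
      fderiv ℝ (lift f) y (EuclideanSpace.single j 1) := by
  have h1 : (fun h : ℝ => f ((fun i => (y i : AddCircle L)) + Pi.single j (h : AddCircle L))) =
      fun h : ℝ => lift f (y + h • EuclideanSpace.single j 1) := by
    ext h
    simp only [lift]
    congr 1
    ext i
    by_cases hij : i = j
    · subst hij
      simp
    · simp [hij]
  have h2 : DifferentiableAt ℝ (lift f) (y + (0 : ℝ) • EuclideanSpace.single j (1 : ℝ)) :=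
    (hf.differentiable (by simp)).differentiableAt
  have h3 : HasDerivAt (fun h : ℝ => y + h • EuclideanSpace.single j (1 : ℝ))
      (EuclideanSpace.single j 1) 0 := by
    simpa using ((hasDerivAt_id (0 : ℝ)).smul_const (EuclideanSpace.single j (1 : ℝ))).const_add y
  rw [pderiv, h1]
  refine (h2.hasFDerivAt.comp_hasDerivAt (0 : ℝ) h3).deriv.trans ?_
  rw [zero_smul, add_zero]

/-- Termwise differentiation, legitimate because `|k| |c_k|` is summable; `∂_j` multiplies a mode by
`i k_j`. -/
theorem RapidDecay.hasSum_pderiv (hL : 0 < L) {c : (Fin d → ℤ) → EuclideanSpace ℂ (Fin d)}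
    (hc : RapidDecay L c) (j : Fin d) (y : Vec d) :
    HasSum (fun n => synth (c n)
        (Complex.I * (2 * Real.pi / L * n j : ℝ) * lift (monomial (L := L) n) y))
      (pderiv j (fieldSeries (L := L) c) fun i => (y i : AddCircle L)) := by
  have hb : ∀ n y, ‖fderiv ℝ (fun y => synth (c n) (lift (monomial (L := L) n) y)) y‖ ≤
      waveNumber d L n ^ 1 * ‖c n‖ := fun n y => by
    have := norm_iteratedFDeriv_synth_le hL 1 (c n) n y
    rwa [norm_iteratedFDeriv_one] at this
  have hd : ∀ n : Fin d → ℤ,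
      Differentiable ℝ fun y => synth (c n) (lift (monomial (L := L) n) y) := fun n =>
    (contDiff_synth_lift_monomial (N := 1) (c n) n).differentiable one_ne_zero
  have hs : Summable fun n => fderiv ℝ (fun y => synth (c n) (lift (monomial (L := L) n) y)) y :=
    Summable.of_norm_bounded (hc 1) fun n => hb n y
  have key : ∀ n, synth (c n)
      (Complex.I * (2 * Real.pi / L * n j : ℝ) * lift (monomial (L := L) n) y) =
      fderiv ℝ (fun y => synth (c n) (lift (monomial (L := L) n) y)) y
        (EuclideanSpace.single j 1) := fun n => by
    have hcomp : HasFDerivAt (fun y => synth (c n) (lift (monomial (L := L) n) y)) _ y :=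
      (synth (c n)).hasFDerivAt.comp y
        ((contDiff_lift_monomial (N := 1) n).differentiable one_ne_zero y).hasFDerivAt
    rw [hcomp.fderiv, ContinuousLinearMap.comp_apply, fderiv_lift_monomial, phase_apply]
    simp
  rw [pderiv_eq_fderiv_lift (hc.isSmooth hL), lift_fieldSeries,
    fderiv_tsum_apply (hc 1) hd hb (hc.summable_synth fun i => (y i : AddCircle L)) y]
  simp only [key]
  exact (ContinuousLinearMap.apply ℝ (Vec d) (EuclideanSpace.single j (1 : ℝ))).hasSum hs.hasSum

theorem RapidDecay.isSmoothDiv (hL : 0 < L) {c : (Fin d → ℤ) → EuclideanSpace ℂ (Fin d)}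
    (hc : RapidDecay L c) (hdiv : ∀ n : Fin d → ℤ, ∑ j, (n j : ℂ) * c n j = 0) :
    IsSmoothDiv (fieldSeries (L := L) c) := by
  refine ⟨hc.isSmooth hL, fun x => ?_⟩
  obtain ⟨y, rfl⟩ : ∃ y : Vec d, (fun i => (y i : AddCircle L)) = x := by
    choose z hz using fun i => QuotientAddGroup.mk_surjective (x i)
    exact ⟨WithLp.toLp 2 z, funext hz⟩
  -- Each mode contributes `Re (i e^{ik·x} k·c_k)` to the divergence, which is zero.
  have h := hasSum_sum fun j (_ : j ∈ Finset.univ) =>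
    (EuclideanSpace.proj (𝕜 := ℝ) j).hasSum (hc.hasSum_pderiv hL j y)
  refine h.unique ?_
  convert hasSum_zero with n
  change ∑ j, (Complex.I * (2 * Real.pi / L * n j : ℝ) * lift (monomial (L := L) n) y * c n j).re = 0
  rw [← Complex.re_sum]
  have h1 : ∑ j, Complex.I * (2 * Real.pi / L * n j : ℝ) * lift (monomial (L := L) n) y * c n j =
      Complex.I * (2 * Real.pi / L : ℝ) * lift (monomial (L := L) n) y *
        ∑ j, (n j : ℂ) * c n j := by
    rw [Finset.mul_sum]
    refine Finset.sum_congr rfl fun j _ => ?_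
    push_cast
    ring
  rw [h1, hdiv, mul_zero, Complex.zero_re]

/-- Since `f` is real, it equals the real part of its complex Fourier series; no Hermitian symmetry
of the coefficients is needed. -/
theorem ae_eq_fieldSeries_coeff [Fact (0 < L)] (f : L2Field d L)
    (hf : RapidDecay L (coeff f)) : f =ᵐ[volume] fieldSeries (coeff f) := by
  filter_upwards [ae_all_iff.2 fun i => ae_eq_tsum_coeff f hf.summable_norm i] with x hx
  ext i
  have h1 : Summable fun n => coeff f n i * monomial n x :=
    Summable.of_norm_bounded hf.summable_norm fun n => by
      rw [norm_mul, norm_monomial_apply, mul_one]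
      exact PiLp.norm_apply_le _ _
  have h2 := (EuclideanSpace.proj (𝕜 := ℝ) i).hasSum (hf.summable_synth x).hasSum
  have h3 := Complex.hasSum_re h1.hasSum
  rw [← hx i, Complex.ofReal_re] at h3
  simp only [mul_comm (coeff f _ i)] at h3
  exact h3.unique h2

end StochNS

namespace StochNS

variable {d : ℕ} {L : ℝ}

/-! ### Exponential weights on the frequency lattice -/

theorem mul_abs_le_waveNumber (hL : 0 < L) (n : Fin d → ℤ) (j : Fin d) :
    2 * Real.pi / L * |(n j : ℝ)| ≤ waveNumber d L n := by
  refine mul_le_mul_of_nonneg_left ?_ (by positivity)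
  rw [← Real.sqrt_sq_eq_abs]
  exact Real.sqrt_le_sqrt
    (Finset.single_le_sum (f := fun j => (n j : ℝ) ^ 2) (fun _ _ => sq_nonneg _)
      (Finset.mem_univ j))

/-- The spectral gap, which lets the `H^1` weight be replaced by a constant off the zero mode. -/
theorem le_waveNumber (hL : 0 < L) {n : Fin d → ℤ} (hn : n ≠ 0) :
    2 * Real.pi / L ≤ waveNumber d L n := by
  obtain ⟨j, hj⟩ := Function.ne_iff.mp hn
  refine le_trans ?_ (mul_abs_le_waveNumber hL n j)
  have h1 : (1 : ℝ) ≤ |(n j : ℝ)| := by exact_mod_cast Int.one_le_abs hj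
  exact le_mul_of_one_le_right (by positivity) h1

theorem summable_prod_int {f : ℤ → ℝ} (hf : Summable f) (h0 : ∀ k, 0 ≤ f k) (d : ℕ) :
    Summable fun n : Fin d → ℤ => ∏ j, f (n j) := by
  induction d with
  | zero => exact (hasSum_fintype _).summable
  | succ d ih =>
    rw [← (Fin.consEquiv fun _ : Fin (d + 1) => ℤ).summable_iff]
    refine (hf.mul_of_nonneg ih h0 fun n => Finset.prod_nonneg fun _ _ => h0 _).congr fun p => ?_
    simp [Fin.prod_univ_succ, Fin.consEquiv]

theorem summable_exp_neg_abs_int {b : ℝ} (hb : 0 < b) :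
    Summable fun k : ℤ => Real.exp (-(b * |(k : ℝ)|)) := by
  have h : Summable fun k : ℕ => Real.exp (-(b * k)) := by
    have := Real.summable_exp_nat_mul_iff.2 (neg_lt_zero.2 hb)
    exact this.congr fun k => by ring_nf
  refine Summable.of_nat_of_neg ?_ ?_ <;> simpa using h

/-- `|k|` dominates a multiple of `∑_j |n_j|`, so the exponential is bounded by a product of
summable one-dimensional exponentials. -/
theorem summable_exp_neg_waveNumber (hL : 0 < L) {a : ℝ} (ha : 0 < a) :
    Summable fun n : Fin d → ℤ => Real.exp (-(a * waveNumber d L n)) := by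
  -- Dividing by `d + 1` instead of `d` keeps the rate positive when `d = 0`.
  have hb : 0 < a * (2 * Real.pi / L) / (d + 1) := by positivity
  refine Summable.of_nonneg_of_le (fun _ => (Real.exp_pos _).le) (fun n => ?_)
    (summable_prod_int (summable_exp_neg_abs_int hb) (fun _ => (Real.exp_pos _).le) d)
  rw [← Real.exp_sum]
  refine Real.exp_le_exp.2 ?_
  rw [Finset.sum_neg_distrib, neg_le_neg_iff, ← Finset.mul_sum]
  have h1 : 2 * Real.pi / L * ∑ j, |(n j : ℝ)| ≤ (d + 1) * waveNumber d L n := by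
    rw [Finset.mul_sum]
    refine (Finset.sum_le_card_nsmul _ _ _ fun j _ => mul_abs_le_waveNumber hL n j).trans ?_
    rw [Finset.card_univ, Fintype.card_fin, nsmul_eq_mul]
    nlinarith [waveNumber_nonneg hL n]
  rw [div_mul_eq_mul_div, div_le_iff₀ (by positivity), mul_assoc, mul_assoc a]
  refine mul_le_mul_of_nonneg_left (h1.trans_eq (mul_comm _ _)) ha.le

theorem summable_pow_mul_exp_neg_waveNumber (hL : 0 < L) {a : ℝ} (ha : 0 < a) (m : ℕ) :
    Summable fun n : Fin d → ℤ => waveNumber d L n ^ m * Real.exp (-(a * waveNumber d L n)) := by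
  refine Summable.of_nonneg_of_le (fun n => ?_) (fun n => ?_)
    ((summable_exp_neg_waveNumber hL (half_pos ha)).mul_left (m.factorial * (2 / a) ^ m))
  · exact mul_nonneg (pow_nonneg (waveNumber_nonneg hL n) _) (Real.exp_pos _).le
  · have hx := waveNumber_nonneg hL n
    set x := waveNumber d L n
    -- Half of the exponential absorbs the power, by one term of the exponential series; the other
    -- half remains summable.
    have h1 : x ^ m ≤ m.factorial * (2 / a) ^ m * Real.exp (a / 2 * x) := by
      have := Real.pow_div_factorial_le_exp (a / 2 * x) (by positivity) m
      rw [div_le_iff₀ (by positivity)] at this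
      calc x ^ m = (2 / a) ^ m * (a / 2 * x) ^ m := by
            rw [← mul_pow]; congr 1; field_simp
        _ ≤ (2 / a) ^ m * (Real.exp (a / 2 * x) * m.factorial) := by gcongr
        _ = _ := by ring
    calc x ^ m * Real.exp (-(a * x))
        ≤ m.factorial * (2 / a) ^ m * Real.exp (a / 2 * x) * Real.exp (-(a * x)) := by gcongr
      _ = m.factorial * (2 / a) ^ m * Real.exp (-(a / 2 * x)) := by
        rw [mul_assoc _ (Real.exp _), ← Real.exp_add]
        congr 2
        ring

/-! ### Gevrey regularity implies smoothness -/

theorem ofReal_waveNumber_mul_enorm_le_seqNorm (hL : 0 < L)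
    (c : (Fin d → ℤ) → EuclideanSpace ℂ (Fin d)) (n : Fin d → ℤ) :
    ENNReal.ofReal (waveNumber d L n) * ‖c n‖ₑ ≤ seqNorm L 1 c := by
  have h1 : (ENNReal.ofReal (waveNumber d L n) * ‖c n‖ₑ) ^ (2 : ℝ) =
      ENNReal.ofReal (waveNumber d L n ^ (2 * (1 : ℝ))) * ‖c n‖ₑ ^ 2 := by
    rw [ENNReal.mul_rpow_of_nonneg _ _ zero_le_two,
      ENNReal.ofReal_rpow_of_nonneg (waveNumber_nonneg hL n) zero_le_two, mul_one,
      ENNReal.rpow_two]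
  rw [seqNorm, one_div, ENNReal.le_rpow_inv_iff zero_lt_two, h1]
  exact ENNReal.le_tsum n

theorem norm_le_of_seqNorm_le (hL : 0 < L) {c : (Fin d → ℤ) → EuclideanSpace ℂ (Fin d)} {M : ℝ}
    (hM : 0 ≤ M) (hc : seqNorm L 1 c ≤ ENNReal.ofReal M) {n : Fin d → ℤ} (hn : n ≠ 0) :
    ‖c n‖ ≤ M / (2 * Real.pi / L) := by
  have h := (ofReal_waveNumber_mul_enorm_le_seqNorm hL c n).trans hc
  rw [← ofReal_norm, ← ENNReal.ofReal_mul (waveNumber_nonneg hL n),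
    ENNReal.ofReal_le_ofReal_iff hM] at h
  rw [le_div_iff₀ (by positivity), mul_comm]
  exact (mul_le_mul_of_nonneg_right (le_waveNumber hL hn) (norm_nonneg _)).trans h

variable [hL : Fact (0 < L)]

theorem coeff_eq_exp_smul_gevreyCoeff (a : ℝ) (f : L2Field d L) (n : Fin d → ℤ) :
    coeff f n = Real.exp (-(a * waveNumber d L n)) • gevreyCoeff 1 a f n := by
  rw [gevreyCoeff, smul_smul, ← Real.exp_add]
  simp

theorem rapidDecay_of_norm_coeff_le {f : L2Field d L} {a B : ℝ} (ha : 0 < a)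
    (hf : ∀ n, ‖coeff f n‖ ≤ B * Real.exp (-(a * waveNumber d L n))) :
    RapidDecay L (coeff f) := fun m => by
  refine Summable.of_nonneg_of_le (fun n => ?_) (fun n => ?_)
    ((summable_pow_mul_exp_neg_waveNumber hL.out ha m).mul_left B)
  · exact mul_nonneg (pow_nonneg (waveNumber_nonneg hL.out n) _) (norm_nonneg _)
  · rw [mul_left_comm]
    exact mul_le_mul_of_nonneg_left (hf n) (pow_nonneg (waveNumber_nonneg hL.out n) _)

/-- The homogeneous norm gives the zero mode weight zero, so that mode has to be controlled by the
vanishing mean. -/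
theorem norm_coeff_le_of_norm_gevreyCoeff_le {f : L2Field d L} (h0 : coeff f 0 = 0) {a B : ℝ}
    (hB : 0 ≤ B) (hf : ∀ n, n ≠ 0 → ‖gevreyCoeff 1 a f n‖ ≤ B) (n : Fin d → ℤ) :
    ‖coeff f n‖ ≤ B * Real.exp (-(a * waveNumber d L n)) := by
  by_cases hn : n = 0
  · rw [hn, h0, norm_zero]
    positivity
  · rw [coeff_eq_exp_smul_gevreyCoeff a, norm_smul, Real.norm_eq_abs, Real.abs_exp, mul_comm]
    exact mul_le_mul_of_nonneg_right (hf n hn) (Real.exp_pos _).le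

theorem MemGevrey.exists_norm_gevreyCoeff_le {f : L2Field d L} {a : ℝ} (hf : MemGevrey 1 1 a f) :
    ∃ B, 0 ≤ B ∧ ∀ n, n ≠ 0 → ‖gevreyCoeff 1 a f n‖ ≤ B := by
  refine ⟨(gevreyNorm 1 1 a f).toReal / (2 * Real.pi / L), ?_, fun n hn => ?_⟩
  · have := hL.out
    positivity
  · exact norm_le_of_seqNorm_le hL.out ENNReal.toReal_nonneg
      (ENNReal.ofReal_toReal hf.finite.ne).ge hn

theorem MemGevrey.rapidDecay {f : L2Field d L} {a : ℝ} (ha : 0 < a) (hf : MemGevrey 1 1 a f) :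
    RapidDecay L (coeff f) := by
  obtain ⟨B, hB, h⟩ := hf.exists_norm_gevreyCoeff_le
  exact rapidDecay_of_norm_coeff_le ha (norm_coeff_le_of_norm_gevreyCoeff_le hf.memH.meanFree hB h)

/-! ### Continuity in time. -/

theorem ContGevrey.tendsto_coeff {S : Set ℝ≥0} {w : ℝ≥0 → L2Field d L}
    (hw : ContGevrey 1 1 (fun t => (t : ℝ)) S w) {t₀ : ℝ≥0} (ht₀ : t₀ ∈ S) (n : Fin d → ℤ) :
    Tendsto (fun t => coeff (w t) n) (𝓝[S] t₀) (𝓝 (coeff (w t₀) n)) := by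
  by_cases hn : n = 0
  · subst hn
    refine tendsto_const_nhds.congr' ?_
    filter_upwards [self_mem_nhdsWithin] with t ht
    rw [(hw.1 t ht).memH.meanFree, (hw.1 t₀ ht₀).memH.meanFree]
  · have h1 : Tendsto (fun t : ℝ≥0 => gevreyCoeff 1 (t : ℝ) (w t) n) (𝓝[S] t₀)
        (𝓝 (gevreyCoeff 1 (t₀ : ℝ) (w t₀) n)) := by
      rw [Metric.tendsto_nhds]
      intro ε hε
      have := hL.out
      -- Dividing by the spectral gap leaves `ε / 2`, which keeps the final inequality strict.
      have hε' : 0 < ε / 2 * (2 * Real.pi / L) := by positivity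
      filter_upwards [(hw.2 t₀ ht₀).eventually (Iio_mem_nhds (ENNReal.ofReal_pos.2 hε'))] with t ht
      have := norm_le_of_seqNorm_le hL.out hε'.le ht.le hn
      rw [mul_div_cancel_right₀ _ (by positivity)] at this
      rw [dist_eq_norm]
      linarith
    -- On a single mode the moving weight is a scalar continuous in `t`, so it can be divided out.
    have h2 : Tendsto (fun t : ℝ≥0 => Real.exp (-((t : ℝ) * waveNumber d L n))) (𝓝[S] t₀)
        (𝓝 (Real.exp (-((t₀ : ℝ) * waveNumber d L n)))) :=
      (Continuous.tendsto (by fun_prop) t₀).mono_left nhdsWithin_le_nhds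
    rw [coeff_eq_exp_smul_gevreyCoeff (t₀ : ℝ)]
    exact (h2.smul h1).congr fun t => (coeff_eq_exp_smul_gevreyCoeff (t : ℝ) (w t) n).symm

/-- Near a positive time, the Fourier coefficients decay exponentially, uniformly in time. -/
theorem ContGevrey.exists_eventually_norm_coeff_le {S : Set ℝ≥0} {w : ℝ≥0 → L2Field d L}
    (hw : ContGevrey 1 1 (fun t => (t : ℝ)) S w) {t₀ : ℝ≥0} (ht₀ : t₀ ∈ S) (hpos : 0 < t₀) :
    ∃ B, 0 ≤ B ∧ ∀ᶠ t in 𝓝[S] t₀, ∀ n,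
      ‖coeff (w t) n‖ ≤ B * Real.exp (-((t₀ : ℝ) / 2 * waveNumber d L n)) := by
  obtain ⟨B, hB, hB'⟩ := (hw.1 t₀ ht₀).exists_norm_gevreyCoeff_le
  have hLpos := hL.out
  have hC : 0 ≤ 1 / (2 * Real.pi / L) := by positivity
  have hhalf : ∀ᶠ t : ℝ≥0 in 𝓝[S] t₀, t₀ / 2 < t :=
    nhdsWithin_le_nhds (Ioi_mem_nhds (NNReal.half_lt_self hpos.ne'))
  -- `B` bounds the weighted coefficients at `t₀`; the other summand bounds their change while the
  -- `H^1` distance is below `1`. The condition `t > t₀ / 2` then fixes a decay rate independent of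
  -- `t`.
  refine ⟨1 / (2 * Real.pi / L) + B, by positivity, ?_⟩
  filter_upwards [(hw.2 t₀ ht₀).eventually
      (Iio_mem_nhds (ENNReal.ofReal_pos.2 (zero_lt_one (α := ℝ)))), hhalf,
    self_mem_nhdsWithin] with t ht hlt htS n
  refine (norm_coeff_le_of_norm_gevreyCoeff_le (a := (t : ℝ)) (hw.1 t htS).memH.meanFree
    (add_nonneg hC hB) (fun n hn => ?_) n).trans ?_
  · have h1 := norm_le_of_seqNorm_le hL.out zero_le_one ht.le hn
    calc ‖gevreyCoeff 1 (t : ℝ) (w t) n‖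
        = ‖(gevreyCoeff 1 (t : ℝ) (w t) n - gevreyCoeff 1 (t₀ : ℝ) (w t₀) n) +
            gevreyCoeff 1 (t₀ : ℝ) (w t₀) n‖ := by rw [sub_add_cancel]
      _ ≤ _ := (norm_add_le _ _).trans (add_le_add h1 (hB' n hn))
  · have h2 : (t₀ : ℝ) / 2 ≤ t := by exact_mod_cast hlt.le
    have := waveNumber_nonneg hL.out n
    gcongr

/-- A process that is continuous with values in the Gevrey spaces `G^{1,1}_t`, `t > 0`, is
continuous with values in `C^∞_div`. -/
theorem ContGevrey.contSmoothDiv {S : Set ℝ≥0} (hS : ∀ t ∈ S, 0 < t) {w : ℝ≥0 → L2Field d L}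
    (hw : ContGevrey 1 1 (fun t => (t : ℝ)) S w) : ContSmoothDiv S w := by
  have hrd : ∀ t ∈ S, RapidDecay L (coeff (w t)) := fun t ht =>
    (hw.1 t ht).rapidDecay (NNReal.coe_pos.2 (hS t ht))
  refine ⟨fun t => fieldSeries (coeff (w t)), fun t ht =>
    ⟨(hrd t ht).isSmoothDiv hL.out (hw.1 t ht).memH.divFree, ae_eq_fieldSeries_coeff _ (hrd t ht)⟩,
    fun m t₀ ht₀ => ?_⟩
  obtain ⟨B, hB, hev⟩ := hw.exists_eventually_norm_coeff_le ht₀ (hS t₀ ht₀)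
  have hlim : Tendsto (fun t => ∑' n, waveNumber d L n ^ m * ‖coeff (w t₀) n - coeff (w t) n‖)
      (𝓝[S] t₀) (𝓝 0) := by
    have ht₀pos : (0 : ℝ) < (t₀ : ℝ) / 2 := half_pos (NNReal.coe_pos.2 (hS t₀ ht₀))
    -- As `t₀ ∈ S`, the eventual bound also holds at `t₀`; the two bounds together give the majorant
    -- `2B |k|^m e^{-t₀|k|/2}`.
    have hself := hev.self_of_nhdsWithin ht₀
    rw [show (0 : ℝ) = ∑' _ : Fin d → ℤ, (0 : ℝ) from tsum_zero.symm]
    refine tendsto_tsum_of_dominated_convergence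
      ((summable_pow_mul_exp_neg_waveNumber hL.out ht₀pos m).mul_left (2 * B)) (fun n => ?_) ?_
    · have h1 := ((hw.tendsto_coeff ht₀ n).const_sub (coeff (w t₀) n)).norm.const_mul
        (waveNumber d L n ^ m)
      simpa using h1
    · filter_upwards [hev] with t ht n
      have hx := waveNumber_nonneg hL.out n
      rw [Real.norm_of_nonneg (by positivity), mul_left_comm]
      refine mul_le_mul_of_nonneg_left ?_ (by positivity)
      refine (norm_sub_le _ _).trans ((add_le_add (hself n) (ht n)).trans_eq (by ring))
  rw [Metric.tendstoUniformly_iff]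
  intro ε hε
  filter_upwards [hlim.eventually (Iio_mem_nhds hε), self_mem_nhdsWithin] with t ht htS y
  rw [dist_eq_norm]
  exact ((hrd t₀ ht₀).norm_iteratedFDeriv_sub_le hL.out (hrd t htS) m y).trans_lt ht

end StochNS

theorem corollary3p7 {d : ℕ} (hd : d = 2 ∨ d = 3) {L : ℝ} [Fact (0 < L)]
    {Ω : Type*} {m : MeasurableSpace Ω} (P : Measure Ω) [IsProbabilityMeasure P]
    (F : Filtration ℝ≥0 m) (hF : StochNS.UsualConditions P F)
    (W : ℕ → ℝ≥0 → Ω → ℝ) (hW : ∀ k, StochNS.IsBrownian P F (W k))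
    (T : ℝ≥0) (hT : 0 < T)
    (D : StochNS.NSData d L Ω) (hν : 0 < D.ν)
    (hg : StochNS.ForceAssumption P T 1 1 (fun t => (t : ℝ)) D.g)
    (r₀ : ℝ) (hr₀ : 4 < r₀) (K : ℝ≥0) (hξ : StochNS.TransportAssumption 1 r₀ T K D.ξ)
    (hu₀ : StronglyMeasurable[F 0] D.u₀) (hu₀H : ∀ᵐ ω ∂P, StochNS.MemH 1 (D.u₀ ω))
    (K₀ : ℝ≥0) (hK₀ : ∀ᵐ ω ∂P, StochNS.sobolevNorm 1 (D.u₀ ω) ^ 2 ≤ K₀)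
    (u : ℝ≥0 → Ω → StochNS.L2Field d L) (τ : Ω → ℝ≥0)
    (hu : StochNS.IsGevreySolution P F T W D 1 1 (fun t => (t : ℝ)) u τ) :
    ∀ᵐ ω ∂P, StochNS.ContSmoothDiv (Set.Ioc 0 T) fun t => u (min t (τ ω)) ω := by
  filter_upwards [hu.gevrey] with ω hω
  exact hω.contSmoothDiv fun t ht => ht.1
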